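/- **Theorem 6.1 (Finite convergence).** Let $G, J : \mathbb{R}^n \to \mathbb{R} \cup \{+\infty\}$ be proper, convex and lower semicontinuous, let $\gamma > 0$, and let $\operatorname{prox}_{\gamma F}(w)$ denote the unique minimizer of $y \mapsto \gamma F(y) + \frac12\|y-w\|^2$. Let $z_0 \in \mathbb{R}^n$, $x_0 = \operatorname{prox}_{\gamma J}(z_0)$, and let the sequences be generated by the unrelaxed stationary Douglas–Rachford iteration $$v_{k+1} = \operatorname{prox}_{\gamma G}(2x_k - z_k), \qquad z_{k+1} = z_k + v_{k+1} - x_k, \qquad x_{k+1} = \operatorname{prox}_{\gamma J}(z_{k+1}), \qquad k \ge 0.$$ Assume that $(z_k, x_k, v_k) \to (z^\star, x^\star, x^\star)$ for some $z^\star, x^\star \in \mathbb{R}^n$, and that $G$ and $J$ are both locally polyhedral around $x^\star$, i.e. each of them coincides in a neighbourhood of $x^\star$ with a function whose epigraph is an intersection of finitely many closed half-spaces of $\mathbb{R}^n \times \mathbb{R}$. Suppose moreover that at least one of $J$ and $G$ is locally $C^2$ at $x^\star$, i.e. finite and twice continuously differentiable in a neighbourhood of $x^\star$. Then there is $K \in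 \mathbb{N}$ such that $z_k = z^\star$, $x_k = x^\star$ and $v_k = x^\star$ for all $k \ge K$. -/

import Mathlib

open Filter Topology

/-- The class of proper convex lower semicontinuous functions on `ℝⁿ`, with values in the
extended reals. Convexity is convexity of the epigraph. -/
structure IsGammaZero {n : ℕ} (F : EuclideanSpace ℝ (Fin n) → EReal) : Prop where
  ne_bot : ∀ y, F y ≠ ⊥
  exists_ne_top : ∃ y, F y ≠ ⊤
  convex_epigraph :
    Convex ℝ {p : EuclideanSpace ℝ (Fin n) × ℝ | F p.1 ≤ (p.2 : EReal)}
  lowerSemicontinuous : LowerSemicontinuous F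

/-- `p = prox_{γF}(w)`: the point `p` minimizes `y ↦ γ F(y) + ‖y - w‖² / 2` over `ℝⁿ`.
For `γ > 0` and `F` proper, convex and lower semicontinuous there is exactly one such `p`. -/
def IsProx {n : ℕ} (γ : ℝ) (F : EuclideanSpace ℝ (Fin n) → EReal)
    (w p : EuclideanSpace ℝ (Fin n)) : Prop :=
  IsMinOn (fun y => (γ : EReal) * F y + ((1 / 2 * ‖y - w‖ ^ 2 : ℝ) : EReal)) Set.univ p

/-- The sequences `z`, `x`, `v` are generated by the Douglas-Rachford iteration for `G + J` with
step sizes `γ k` and relaxation parameters `lam k`. The algorithm produces `v k` for `k ≥ 1` only,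
so that `v 0` is unconstrained. -/
structure IsDouglasRachford {n : ℕ} (G J : EuclideanSpace ℝ (Fin n) → EReal) (γ lam : ℕ → ℝ)
    (z x v : ℕ → EuclideanSpace ℝ (Fin n)) : Prop where
  x_zero : IsProx (γ 0) J (z 0) (x 0)
  v_succ : ∀ k, IsProx (γ k) G ((2 : ℝ) • x k - z k) (v (k + 1))
  z_succ : ∀ k, z (k + 1) = (1 - lam k) • z k + lam k • (z k + v (k + 1) - x k)
  x_succ : ∀ k, IsProx (γ (k + 1)) J (z (k + 1)) (x (k + 1))

/-- A function is polyhedral if its epigraph is a polyhedron in `ℝⁿ × ℝ`, that is, an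
intersection of finitely many closed half-spaces `{(y, t) | ⟨a, y⟩ + b t ≤ c}`. -/
def IsPolyhedralFun {n : ℕ} (P : EuclideanSpace ℝ (Fin n) → EReal) : Prop :=
  ∃ (m : ℕ) (a : Fin m → EuclideanSpace ℝ (Fin n)) (b c : Fin m → ℝ),
    ∀ (y : EuclideanSpace ℝ (Fin n)) (t : ℝ),
      P y ≤ (t : EReal) ↔ ∀ i, inner ℝ (a i) y + b i * t ≤ c i

/-- `F` is locally polyhedral around `x₀`: it coincides near `x₀` with a polyhedral function. -/
def IsLocallyPolyhedralAt {n : ℕ} (F : EuclideanSpace ℝ (Fin n) → EReal)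
    (x₀ : EuclideanSpace ℝ (Fin n)) : Prop :=
  ∃ P : EuclideanSpace ℝ (Fin n) → EReal, IsPolyhedralFun P ∧ ∀ᶠ y in 𝓝 x₀, F y = P y

/-- `F` is locally `C²` at `x₀`: it is finite near `x₀` and coincides there with a real-valued
function that is twice continuously differentiable in a neighbourhood of `x₀`. -/
def IsLocallyC2At {n : ℕ} (F : EuclideanSpace ℝ (Fin n) → EReal)
    (x₀ : EuclideanSpace ℝ (Fin n)) : Prop :=
  ∃ f : EuclideanSpace ℝ (Fin n) → ℝ, ContDiffAt ℝ 2 f x₀ ∧ ∀ᶠ y in 𝓝 x₀, F y = (f y : EReal)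

/-!
Whichever of `G` and `J` is locally `C²` at `xstar` is, being also locally polyhedral, affine there
(`IsPolyhedralFun.eventually_eq_affine`): the directional derivatives of a polyhedral function
are attained on a whole neighbourhood, and differentiability makes them linear in the direction.
The proximal step of a function that is affine with slope `g` is the translation by `-γ g`
(`IsProx.eq_of_affine`), so the Douglas-Rachford iteration collapses to
`x (k + 1) = prox_{γF} (x k - γ g)`, where `F` is the other function. This is the proximal point
algorithm for the locally polyhedral function `F + ⟪g, ·⟫`.

That algorithm stops after finitely many steps (`eventually_eq_of_isProx_shift`). Write the epigraph
of `F` near `xstar` as an intersection of half-spaces, and let `A` be the set of constraints active at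
`(x (k + 1), F (x (k + 1)))`. The optimality condition of the proximal step says that
`γ (s + ⟪g, d⟫) + ⟪x (k + 1) - x k, d⟫ ≥ 0` for all directions `(d, s)` in the tangent cone of `A`
(`IsProx.nonneg_of_tangent`). There are only finitely many sets `A`, and `x (k + 1) - x k → 0`;
so from some `k` on the condition holds without the last term. Then `x (k + 1)` minimizes
`F + ⟪g, ·⟫` near `xstar`, and the next proximal step does not move it.
-/

/-! ### Proximal points -/

section Prox

variable {n : ℕ} {F : EuclideanSpace ℝ (Fin n) → EReal} {γ : ℝ}
  {w p : EuclideanSpace ℝ (Fin n)}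

theorem IsProx.ne_top (h : IsProx γ F w p) (hγ : 0 < γ) (hF : IsGammaZero F) : F p ≠ ⊤ := by
  obtain ⟨y, hy⟩ := hF.exists_ne_top
  intro hp
  have h1 := h (Set.mem_univ y)
  lift F y to ℝ using ⟨hy, hF.ne_bot y⟩ with r hr
  simp only [Set.mem_ofPred_eq, hp, ← hr, EReal.coe_mul_top_of_pos hγ, EReal.top_add_coe,
    top_le_iff] at h1
  rw [← EReal.coe_mul, ← EReal.coe_add] at h1
  exact EReal.coe_ne_top _ h1

theorem IsProx.exists_coe_eq (h : IsProx γ F w p) (hγ : 0 < γ) (hF : IsGammaZero F) :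
    ∃ τ : ℝ, F p = τ :=
  ⟨(F p).toReal, (EReal.coe_toReal (h.ne_top hγ hF) (hF.ne_bot p)).symm⟩

/-- The minimality of a proximal point as an inequality between real numbers. -/
theorem IsProx.real_le (h : IsProx γ F w p) (hγ : 0 < γ) {τ t : ℝ} (hp : F p = τ)
    {y : EuclideanSpace ℝ (Fin n)} (hy : F y ≤ t) :
    γ * τ + 1 / 2 * ‖p - w‖ ^ 2 ≤ γ * t + 1 / 2 * ‖y - w‖ ^ 2 := by
  have h1 := h (Set.mem_univ y)
  simp only [Set.mem_ofPred_eq, hp] at h1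
  have h2 : (γ : EReal) * F y ≤ (γ : EReal) * (t : EReal) :=
    mul_le_mul_of_nonneg_left hy (EReal.coe_nonneg.2 hγ.le)
  have h3 := h1.trans (add_le_add_left h2 _)
  exact_mod_cast h3

/-- The first-order inequality at a proximal point `p`, for a direction `(d, s)` that stays in the
epigraph of `F` for a short while. -/
theorem IsProx.nonneg_of_eventually_le (h : IsProx γ F w p) (hγ : 0 < γ) {τ : ℝ} (hp : F p = τ)
    {d : EuclideanSpace ℝ (Fin n)} {s : ℝ}
    (hd : ∀ᶠ ε : ℝ in 𝓝[>] 0, F (p + ε • d) ≤ ((τ + ε * s : ℝ) : EReal)) :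
    0 ≤ γ * s + inner ℝ (p - w) d := by
  have key : ∀ᶠ ε : ℝ in 𝓝[>] 0, 0 ≤ γ * s + inner ℝ (p - w) d + ε * (1 / 2 * ‖d‖ ^ 2) := by
    filter_upwards [hd, self_mem_nhdsWithin] with ε h1 (hε : 0 < ε)
    have h2 := h.real_le hγ hp h1
    rw [show p + ε • d - w = (p - w) + ε • d by abel, norm_add_sq_real, norm_smul,
      inner_smul_right, Real.norm_eq_abs, mul_pow, sq_abs] at h2
    refine nonneg_of_mul_nonneg_right ?_ hε
    linarith
  have hlim : Tendsto (fun ε : ℝ => γ * s + inner ℝ (p - w) d + ε * (1 / 2 * ‖d‖ ^ 2))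
      (𝓝[>] 0) (𝓝 (γ * s + inner ℝ (p - w) d)) := by
    refine Tendsto.mono_left ?_ nhdsWithin_le_nhds
    have : Continuous fun ε : ℝ => γ * s + inner ℝ (p - w) d + ε * (1 / 2 * ‖d‖ ^ 2) := by
      fun_prop
    simpa using this.tendsto 0
  exact ge_of_tendsto hlim key

theorem eventually_add_smul_of_eventually_nhds {Q : EuclideanSpace ℝ (Fin n) → Prop}
    (hQ : ∀ᶠ y in 𝓝 p, Q y) (d : EuclideanSpace ℝ (Fin n)) :
    ∀ᶠ ε : ℝ in 𝓝[>] 0, Q (p + ε • d) := by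
  have hc : Continuous fun ε : ℝ => p + ε • d := by fun_prop
  have ht : Tendsto (fun ε : ℝ => p + ε • d) (𝓝[>] 0) (𝓝 p) := by
    simpa using (hc.tendsto 0).mono_left (nhdsWithin_le_nhds (s := Set.Ioi 0))
  exact ht.eventually hQ

/-- Where `F` is affine with slope `g`, the proximal step is the translation by `-γ g`. -/
theorem IsProx.eq_of_affine (h : IsProx γ F w p) (hγ : 0 < γ)
    {g : EuclideanSpace ℝ (Fin n)} {c : ℝ}
    (hF : ∀ᶠ y in 𝓝 p, F y = ((c + inner ℝ g y : ℝ) : EReal)) : p = w - γ • g := by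
  have h1 := h.nonneg_of_eventually_le (d := -(γ • g + (p - w)))
    (s := inner ℝ g (-(γ • g + (p - w)))) hγ hF.self_of_nhds <| by
      filter_upwards [eventually_add_smul_of_eventually_nhds hF _] with ε h2
      rw [h2, inner_add_right, inner_smul_right, add_assoc]
  rw [← real_inner_smul_left, ← inner_add_left, inner_neg_right, Left.nonneg_neg_iff] at h1
  have h2 := inner_self_eq_zero.1 (h1.antisymm real_inner_self_nonneg)
  rw [← sub_eq_zero, ← h2]
  abel

end Prox

/-! ### Polyhedral functions -/

section Polyhedral

variable {n m : ℕ} {F : EuclideanSpace ℝ (Fin n) → EReal}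
  {a : Fin m → EuclideanSpace ℝ (Fin n)} {b c : Fin m → ℝ}

/-- The optimality condition of a proximal step of a function that is polyhedral near `p`: the
objective does not decrease along the directions `(d, s)` in the tangent cone of the epigraph at
`(p, F p)`, which is cut out by the constraints active there. -/
theorem IsProx.nonneg_of_tangent {γ : ℝ} {w p : EuclideanSpace ℝ (Fin n)} (h : IsProx γ F w p)
    (hγ : 0 < γ) {τ : ℝ} (hp : F p = τ)
    (hF : ∀ᶠ y in 𝓝 p, ∀ t : ℝ, F y ≤ t ↔ ∀ i, inner ℝ (a i) y + b i * t ≤ c i)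
    {d : EuclideanSpace ℝ (Fin n)} {s : ℝ}
    (hd : ∀ i, inner ℝ (a i) p + b i * τ = c i → inner ℝ (a i) d + b i * s ≤ 0) :
    0 ≤ γ * s + inner ℝ (p - w) d := by
  refine h.nonneg_of_eventually_le hγ hp ?_
  have hle := (hF.self_of_nhds τ).1 hp.le
  have hall : ∀ᶠ ε : ℝ in 𝓝[>] 0, ∀ i,
      inner ℝ (a i) (p + ε • d) + b i * (τ + ε * s) ≤ c i := by
    refine eventually_all.2 fun i => ?_
    rcases (hle i).lt_or_eq with hlt | heq
    · have hc : Continuous fun ε : ℝ => inner ℝ (a i) (p + ε • d) + b i * (τ + ε * s) := by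
        fun_prop
      have ht := (hc.tendsto 0).mono_left (nhdsWithin_le_nhds (s := Set.Ioi 0))
      simp only [zero_smul, zero_mul, add_zero] at ht
      exact (ht.eventually_lt_const hlt).mono fun _ => le_of_lt
    · filter_upwards [self_mem_nhdsWithin] with ε (hε : 0 < ε)
      rw [inner_add_right, inner_smul_right]
      nlinarith [mul_nonpos_of_nonneg_of_nonpos hε.le (hd i heq)]
  filter_upwards [eventually_add_smul_of_eventually_nhds hF d, hall] with ε h1 h2
  exact (h1 _).2 h2

/-- A polyhedral function that is real-valued near `x₀` and differentiable at `x₀` is affine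
near `x₀`. -/
theorem IsPolyhedralFun.eventually_eq_affine {P : EuclideanSpace ℝ (Fin n) → EReal}
    (hP : IsPolyhedralFun P) {f : EuclideanSpace ℝ (Fin n) → ℝ} {x₀ : EuclideanSpace ℝ (Fin n)}
    (hf : DifferentiableAt ℝ f x₀) (hPf : ∀ᶠ y in 𝓝 x₀, P y = (f y : EReal)) :
    ∃ (g : EuclideanSpace ℝ (Fin n)) (r : ℝ),
      ∀ᶠ y in 𝓝 x₀, P y = ((r + inner ℝ g y : ℝ) : EReal) := by
  obtain ⟨m, a, b, c, habc⟩ := hP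
  set g := gradient f x₀
  have hepi : ∀ᶠ y in 𝓝 x₀, ∀ t : ℝ, f y ≤ t ↔ ∀ i, inner ℝ (a i) y + b i * t ≤ c i := by
    filter_upwards [hPf] with y hy t
    rw [← habc, hy, EReal.coe_le_coe_iff]
  have hx₀ := (hepi.self_of_nhds (f x₀)).1 le_rfl
  have hlim : ∀ d, Tendsto (fun ε : ℝ => ε⁻¹ * (f (x₀ + ε • d) - f x₀)) (𝓝[>] 0)
      (𝓝 (inner ℝ g d)) := fun d => by
    have h1 := (hf.hasGradientAt.hasFDerivAt.hasLineDerivAt d).tendsto_slope_zero_right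
    rwa [InnerProductSpace.toDual_apply_apply] at h1
  -- The inactive constraints at `(x₀, f x₀)` hold near that point.
  have hinact : ∀ᶠ y in 𝓝 x₀, ∀ i, inner ℝ (a i) x₀ + b i * f x₀ < c i →
      inner ℝ (a i) y + b i * (f x₀ + inner ℝ g (y - x₀)) ≤ c i := by
    refine eventually_all.2 fun i => ?_
    by_cases hi : inner ℝ (a i) x₀ + b i * f x₀ < c i
    · have hc : Continuous fun y =>
          inner ℝ (a i) y + b i * (f x₀ + inner ℝ g (y - x₀)) := by fun_prop
      have ht := hc.tendsto x₀
      simp only [sub_self, inner_zero_right, add_zero] at ht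
      exact (ht.eventually_lt_const hi).mono fun _ h _ => h.le
    · exact Eventually.of_forall fun _ h => absurd h hi
  refine ⟨g, f x₀ - inner ℝ g x₀, ?_⟩
  filter_upwards [hPf, hepi, hinact] with y hy hye hyi
  rw [hy, EReal.coe_eq_coe_iff, sub_add_eq_add_sub, add_sub_assoc, ← inner_sub_right]
  have hnear := eventually_add_smul_of_eventually_nhds hepi (y - x₀)
  apply le_antisymm
  · refine (hye _).2 fun i => ?_
    rcases (hx₀ i).lt_or_eq with hlt | heq
    · exact hyi i hlt
    · -- An active constraint passes to the limit of the difference quotients.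
      have h1 : ∀ᶠ ε : ℝ in 𝓝[>] 0, inner ℝ (a i) (y - x₀) +
          b i * (ε⁻¹ * (f (x₀ + ε • (y - x₀)) - f x₀)) ≤ 0 := by
        filter_upwards [hnear, self_mem_nhdsWithin] with ε h2 (hε : 0 < ε)
        have h3 := (h2 _).1 le_rfl i
        rw [inner_add_right, inner_smul_right] at h3
        refine nonpos_of_mul_nonpos_right ?_ hε
        have h4 : ε * (inner ℝ (a i) (y - x₀) +
            b i * (ε⁻¹ * (f (x₀ + ε • (y - x₀)) - f x₀))) =
            ε * inner ℝ (a i) (y - x₀) + b i * (f (x₀ + ε • (y - x₀)) - f x₀) := by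
          field_simp
        rw [h4]
        linarith
      have h2 := le_of_tendsto (((hlim (y - x₀)).const_mul (b i)).const_add
        (inner ℝ (a i) (y - x₀))) h1
      rw [inner_sub_right] at h2
      linarith
  · -- The segment from `(x₀, f x₀)` to `(y, f y)` lies in the epigraph.
    have h1 : ∀ᶠ ε : ℝ in 𝓝[>] 0, ε⁻¹ * (f (x₀ + ε • (y - x₀)) - f x₀) ≤ f y - f x₀ := by
      filter_upwards [hnear, self_mem_nhdsWithin, mem_nhdsWithin_of_mem_nhds (Iic_mem_nhds one_pos)]
        with ε h2 (hε : 0 < ε) (hε1 : ε ≤ 1)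
      rw [inv_mul_le_iff₀ hε, sub_le_iff_le_add]
      refine (h2 _).2 fun i => ?_
      rw [inner_add_right, inner_smul_right, inner_sub_right]
      have h3 := mul_le_mul_of_nonneg_left ((hye _).1 le_rfl i) hε.le
      have h4 := mul_le_mul_of_nonneg_left (hx₀ i) (sub_nonneg.2 hε1)
      linarith
    have h2 := le_of_tendsto (hlim (y - x₀)) h1
    linarith

theorem IsLocallyPolyhedralAt.eventually_eq_affine {x₀ : EuclideanSpace ℝ (Fin n)}
    (hF : IsLocallyPolyhedralAt F x₀) (hC2 : IsLocallyC2At F x₀) :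
    ∃ (g : EuclideanSpace ℝ (Fin n)) (r : ℝ),
      ∀ᶠ y in 𝓝 x₀, F y = ((r + inner ℝ g y : ℝ) : EReal) := by
  obtain ⟨P, hP, hFP⟩ := hF
  obtain ⟨f, hf, hFf⟩ := hC2
  obtain ⟨g, r, hgr⟩ := hP.eventually_eq_affine (hf.differentiableAt (by norm_num))
    ((hFP.and hFf).mono fun y hy => hy.1.symm.trans hy.2)
  exact ⟨g, r, (hFP.and hgr).mono fun y hy => hy.1.trans hy.2⟩

end Polyhedral

/-! ### Finite convergence -/

theorem eventually_atTop_add_iff {p : ℕ → Prop} (m : ℕ) :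
    (∀ᶠ k in atTop, p (k + m)) ↔ ∀ᶠ k in atTop, p k := by
  rw [← eventually_map (m := (· + m)), map_add_atTop_eq_nat]

/-- Finite convergence of the proximal point algorithm for `F + ⟪g, ·⟫` when `F` is locally
polyhedral at the limit. -/
theorem eventually_eq_of_isProx_shift {n : ℕ} {F : EuclideanSpace ℝ (Fin n) → EReal}
    (hF : IsGammaZero F) {γ : ℝ} (hγ : 0 < γ) {x : ℕ → EuclideanSpace ℝ (Fin n)}
    {x₀ g : EuclideanSpace ℝ (Fin n)} (hx : Tendsto x atTop (𝓝 x₀))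
    (hpoly : IsLocallyPolyhedralAt F x₀)
    (hprox : ∀ᶠ k in atTop, IsProx γ F (x k - γ • g) (x (k + 1))) :
    ∀ᶠ k in atTop, x k = x₀ := by
  obtain ⟨P, ⟨m, a, b, c, habc⟩, hFP⟩ := hpoly
  have hepi : ∀ᶠ y in 𝓝 x₀, ∀ t : ℝ, F y ≤ t ↔ ∀ i, inner ℝ (a i) y + b i * t ≤ c i := by
    filter_upwards [hFP] with y hy t
    rw [hy, habc]
  have hx1 : Tendsto (fun k => x (k + 1)) atTop (𝓝 x₀) := (tendsto_add_atTop_iff_nat 1).2 hx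
  have hx2 : Tendsto (fun k => x (k + 2)) atTop (𝓝 x₀) := (tendsto_add_atTop_iff_nat 2).2 hx
  have hdiff : Tendsto (fun k => x (k + 1) - x k) atTop (𝓝 0) := by simpa using hx1.sub hx
  -- Only finitely many tangent cones occur, so the vanishing term `x (k + 1) - x k` can be
  -- dropped from the optimality condition on all of them simultaneously.
  have hcone : ∀ᶠ k in atTop, ∀ A : Set (Fin m),
      (∀ (d : EuclideanSpace ℝ (Fin n)) (s : ℝ), (∀ i ∈ A, inner ℝ (a i) d + b i * s ≤ 0) →
        0 ≤ γ * (s + inner ℝ g d) + inner ℝ (x (k + 1) - x k) d) →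
      ∀ (d : EuclideanSpace ℝ (Fin n)) (s : ℝ), (∀ i ∈ A, inner ℝ (a i) d + b i * s ≤ 0) →
        0 ≤ s + inner ℝ g d := by
    refine eventually_all.2 fun A => ?_
    by_cases hA : ∀ (d : EuclideanSpace ℝ (Fin n)) (s : ℝ),
        (∀ i ∈ A, inner ℝ (a i) d + b i * s ≤ 0) → 0 ≤ s + inner ℝ g d
    · exact Eventually.of_forall fun _ _ => hA
    · push Not at hA
      obtain ⟨d, s, hds, hneg⟩ := hA
      have ht : Tendsto (fun k => γ * (s + inner ℝ g d) + inner ℝ (x (k + 1) - x k) d) atTop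
          (𝓝 (γ * (s + inner ℝ g d))) := by
        simpa using (hdiff.inner (tendsto_const_nhds (x := d))).const_add (γ * (s + inner ℝ g d))
      filter_upwards [ht.eventually_lt_const (mul_neg_of_pos_of_neg hγ hneg)] with k hk h
      exact absurd (h d s hds) (not_le.2 hk)
  have hstep : ∀ᶠ k in atTop, x (k + 2) = x (k + 1) := by
    filter_upwards [hprox, (tendsto_add_atTop_nat 1).eventually hprox,
      hx1.eventually hepi.eventually_nhds, hx2.eventually hepi, hcone] with k h1 h2 he1 he2 hk
    obtain ⟨τ, hτ⟩ := h1.exists_coe_eq hγ hF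
    obtain ⟨σ, hσ⟩ := h2.exists_coe_eq hγ hF
    -- Optimality over the tangent cone of the active constraints at `(x (k + 1), τ)`, applied to
    -- the direction from there to `(x (k + 2), σ)`.
    have hmin : 0 ≤ (σ - τ) + inner ℝ g (x (k + 2) - x (k + 1)) := by
      refine hk {i | inner ℝ (a i) (x (k + 1)) + b i * τ = c i} (fun d s hds => ?_) _ _
        fun i (hi : inner ℝ (a i) (x (k + 1)) + b i * τ = c i) => ?_
      · have h3 := h1.nonneg_of_tangent hγ hτ he1 hds
        rw [sub_sub_eq_add_sub, add_sub_right_comm, inner_add_left, real_inner_smul_left] at h3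
        linarith
      · have h3 := (he2 σ).1 hσ.le i
        rw [inner_sub_right]
        linarith
    have h3 := h2.real_le hγ hσ hτ.le
    simp only [sub_sub_cancel] at h3
    rw [sub_sub_eq_add_sub, add_sub_right_comm, norm_add_sq_real, inner_smul_right,
      real_inner_comm] at h3
    have h4 := mul_nonneg hγ.le hmin
    have h5 : ‖x (k + 2) - x (k + 1)‖ ^ 2 ≤ 0 := by
      simp only [add_assoc, Nat.reduceAdd] at h3 ⊢
      linarith
    have h6 := (sq_nonpos_iff _).1 h5
    exact sub_eq_zero.1 (norm_eq_zero.1 h6)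
  obtain ⟨K, hK⟩ := eventually_atTop.1 hstep
  have hconst : ∀ k ≥ K + 1, x k = x (K + 1) := fun k hk => by
    induction k, hk using Nat.le_induction with
    | base => rfl
    | succ j hj ih =>
      obtain ⟨i, rfl⟩ : ∃ i, j = i + 1 := ⟨j - 1, by omega⟩
      rw [← ih]
      exact hK i (by omega)
  have hlim : x₀ = x (K + 1) := tendsto_nhds_unique hx <|
    tendsto_const_nhds.congr' (eventually_atTop.2 ⟨K + 1, fun k hk => (hconst k hk).symm⟩)
  exact eventually_atTop.2 ⟨K + 1, fun k hk => (hconst k hk).trans hlim.symm⟩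

theorem theorem6p1 (n : ℕ) (G J : EuclideanSpace ℝ (Fin n) → EReal)
    (hG : IsGammaZero G) (hJ : IsGammaZero J)
    (γ : ℝ) (hγ : 0 < γ)
    (z x v : ℕ → EuclideanSpace ℝ (Fin n))
    (hDR : IsDouglasRachford G J (fun _ => γ) (fun _ => 1) z x v)
    (zstar xstar : EuclideanSpace ℝ (Fin n))
    (hz : Tendsto z atTop (𝓝 zstar))
    (hx : Tendsto x atTop (𝓝 xstar))
    (hv : Tendsto v atTop (𝓝 xstar))
    (hGpoly : IsLocallyPolyhedralAt G xstar)
    (hJpoly : IsLocallyPolyhedralAt J xstar)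
    (hC2 : IsLocallyC2At J xstar ∨ IsLocallyC2At G xstar) :
    ∃ K : ℕ, ∀ k ≥ K, z k = zstar ∧ x k = xstar ∧ v k = xstar := by
  have hzs : ∀ k, z (k + 1) = z k + v (k + 1) - x k := fun k => by
    simpa using hDR.z_succ k
  have hx1 : Tendsto (fun k => x (k + 1)) atTop (𝓝 xstar) := (tendsto_add_atTop_iff_nat 1).2 hx
  have hz1 : Tendsto (fun k => z (k + 1)) atTop (𝓝 zstar) := (tendsto_add_atTop_iff_nat 1).2 hz
  have hv1 : Tendsto (fun k => v (k + 1)) atTop (𝓝 xstar) := (tendsto_add_atTop_iff_nat 1).2 hv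
  -- In both cases `z` is eventually a fixed translate of `x`, up to a shift of the index, so it
  -- becomes constant together with `x`; so does `v`, by `v (k + 1) = z (k + 1) - z k + x k`.
  have hxz : (∀ᶠ k in atTop, x k = xstar) ∧ ∀ᶠ k in atTop, z k = zstar := by
    rcases hC2 with h | h
    · obtain ⟨g, r, hgr⟩ := hJpoly.eventually_eq_affine h
      have hz' : ∀ᶠ k in atTop, z (k + 1) = x (k + 1) + γ • g := by
        filter_upwards [hx1.eventually hgr.eventually_nhds] with k hk
        rw [(hDR.x_succ k).eq_of_affine hγ hk, sub_add_cancel]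
      have hz0 : ∀ᶠ k in atTop, z k = x k + γ • g :=
        (eventually_atTop_add_iff (p := fun k => z k = x k + γ • g) 1).1 hz'
      have hprox : ∀ᶠ k in atTop, IsProx γ G (x k - γ • g) (x (k + 1)) := by
        filter_upwards [hz0, hz'] with k h0 h1
        have h2 := hDR.v_succ k
        have h3 : v (k + 1) = x (k + 1) := by
          have h4 := hzs k
          rw [h0, h1] at h4
          have h5 : v (k + 1) = (x k + γ • g + v (k + 1) - x k) - γ • g := by abel
          rw [h5, ← h4, add_sub_cancel_right]
        rw [h3, h0, two_smul, add_sub_add_left_eq_sub] at h2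
        exact h2
      have hxe := eventually_eq_of_isProx_shift hG hγ hx hGpoly hprox
      refine ⟨hxe, ?_⟩
      have hstar : zstar = xstar + γ • g :=
        tendsto_nhds_unique hz ((hx.add_const (γ • g)).congr' (hz0.mono fun _ h => h.symm))
      filter_upwards [hz0, hxe] with k h0 h1
      rw [h0, h1, hstar]
    · obtain ⟨g, r, hgr⟩ := hGpoly.eventually_eq_affine h
      have hz' : ∀ᶠ k in atTop, z (k + 1) = x k - γ • g := by
        filter_upwards [hv1.eventually hgr.eventually_nhds] with k hk
        rw [hzs k, (hDR.v_succ k).eq_of_affine hγ hk, two_smul]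
        abel
      have hprox : ∀ᶠ k in atTop, IsProx γ J (x k - γ • g) (x (k + 1)) := by
        filter_upwards [hz'] with k h1
        rw [← h1]
        exact hDR.x_succ k
      have hxe := eventually_eq_of_isProx_shift hJ hγ hx hJpoly hprox
      refine ⟨hxe, ?_⟩
      have hstar : zstar = xstar - γ • g :=
        tendsto_nhds_unique hz1 ((hx.sub_const (γ • g)).congr' (hz'.mono fun _ h => h.symm))
      refine (eventually_atTop_add_iff (p := fun k => z k = zstar) 1).1 ?_
      filter_upwards [hz', hxe] with k h0 h1
      rw [h0, h1, hstar]
  obtain ⟨hxe, hze⟩ := hxz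
  have hve : ∀ᶠ k in atTop, v k = xstar := by
    refine (eventually_atTop_add_iff (p := fun k => v k = xstar) 1).1 ?_
    filter_upwards [hxe, hze, (tendsto_add_atTop_nat 1).eventually hze] with k h0 h1 h2
    have h3 := hzs k
    rw [h0, h1, h2, add_sub_assoc, left_eq_add] at h3
    exact sub_eq_zero.1 h3
  exact eventually_atTop.1 (hze.and (hxe.and hve))
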